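/- Let $\mathrm{Vir}$ be the complex Virasoro algebra, with basis $L_m$ ($m\in\mathbb{Z}$) and $C$, and brackets $$[L_m,L_n]=(m-n)L_{m+n}+\frac{C}{12}(m^3-m)\,\delta_{m+n,0},\qquad [C,L_m]=0 .$$ For $c,\Delta\in\mathbb{C}$ let $V_\Delta$ be the Verma module with central charge $c$ and highest weight $\Delta$, that is, the quotient of the universal enveloping algebra $U(\mathrm{Vir})$ by the left ideal generated by the $L_m$ with $m\ge 1$, by $L_0-\Delta$ and by $C-c$; let $|\Delta\rangle$ denote its highest weight vector, the class of $1$. A singular vector at level $l$ in $V_\Delta$ is a vector $\Psi\in V_\Delta$ that is not proportional to $|\Delta\rangle$ (in particular $\Psi\ne 0$) and satisfies $L_m\Psi=0$ for all $m\ge 1$ and $L_0\Psi=(\Delta+l)\Psi$. Theorem. Let $c,\Delta\in\mathbb{C}$ and let $l\ge 1$ be an integer. If $V_\Delta$ contains a singular vector at level $l$, then it is unique up to proportionality: for any two singular vectors $\Psi_1,\Psi_2$ at level $l$ in $V_\Delta$ there is a nonzero $a\in\mathbb{C}$ with $\Psi_2=a\Psi_1$. -/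

import Mathlib

/-- The underlying vector space of the (complex) Virasoro algebra: it has the basis `L m` (`m : ℤ`)
together with the central element `C`.  The pair `(f, z)` stands for `∑ m, f m • L m + z • C`. -/
def VirasoroAlgebra : Type := (ℤ →₀ ℂ) × ℂ

namespace VirasoroAlgebra

noncomputable instance : AddCommGroup VirasoroAlgebra :=
  inferInstanceAs (AddCommGroup ((ℤ →₀ ℂ) × ℂ))

noncomputable instance : Module ℂ VirasoroAlgebra :=
  inferInstanceAs (Module ℂ ((ℤ →₀ ℂ) × ℂ))

/-- The generator `L m`. -/
noncomputable def L (m : ℤ) : VirasoroAlgebra := (Finsupp.single m 1, 0)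

/-- The central generator `C`. -/
noncomputable def C : VirasoroAlgebra := (0, 1)

/-- The bilinear map with `(L m, L n) ↦ (m - n) L (m + n)` (the component without `C`). -/
noncomputable def wittBracket : (ℤ →₀ ℂ) →ₗ[ℂ] (ℤ →₀ ℂ) →ₗ[ℂ] (ℤ →₀ ℂ) :=
  Finsupp.linearCombination ℂ fun m : ℤ =>
    Finsupp.linearCombination ℂ fun n : ℤ => Finsupp.single (m + n) ((m : ℂ) - (n : ℂ))

/-- The bilinear form with `(L m, L n) ↦ (m ^ 3 - m) / 12` if `m + n = 0` and `0` otherwise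
(the coefficient of `C`). -/
noncomputable def cocycle : (ℤ →₀ ℂ) →ₗ[ℂ] (ℤ →₀ ℂ) →ₗ[ℂ] ℂ :=
  Finsupp.linearCombination ℂ fun m : ℤ =>
    Finsupp.linearCombination ℂ fun n : ℤ =>
      if m + n = 0 then ((m : ℂ) ^ 3 - (m : ℂ)) / 12 else 0

theorem wittBracket_single' (m n : ℤ) (a b : ℂ) :
    wittBracket (Finsupp.single m a) (Finsupp.single n b)
      = Finsupp.single (m + n) (a * b * ((m : ℂ) - (n : ℂ))) := by
  simp only [wittBracket, Finsupp.linearCombination_single, LinearMap.smul_apply,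
    Finsupp.smul_single, smul_eq_mul, mul_assoc]

theorem cocycle_single' (m n : ℤ) (a b : ℂ) :
    cocycle (Finsupp.single m a) (Finsupp.single n b)
      = a * b * (if m + n = 0 then ((m : ℂ) ^ 3 - (m : ℂ)) / 12 else 0) := by
  simp [cocycle, mul_assoc]

theorem wittBracket_self (x : ℤ →₀ ℂ) : wittBracket x x = 0 := by
  have h : wittBracket + wittBracket.flip = 0 := by
    ext m n : 4
    simp only [LinearMap.comp_apply, LinearMap.add_apply, LinearMap.flip_apply,
      Finsupp.lsingle_apply, wittBracket_single', add_comm n m, LinearMap.zero_apply,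
      ← Finsupp.single_add]
    rw [← Finsupp.single_zero (m + n)]
    congr 1
    ring
  have h2 : wittBracket x x + wittBracket x x = 0 := by
    simpa using congrArg (fun f => f x x) h
  exact self_eq_neg.mp (eq_neg_of_add_eq_zero_left h2)

theorem cocycle_self (x : ℤ →₀ ℂ) : cocycle x x = 0 := by
  have h : cocycle + cocycle.flip = 0 := by
    ext m n
    simp only [LinearMap.comp_apply, LinearMap.add_apply, LinearMap.flip_apply,
      Finsupp.lsingle_apply, cocycle_single', add_comm n m, LinearMap.zero_apply]
    split_ifs with hmn
    · obtain rfl : n = -m := by omega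
      push_cast
      ring
    · ring
  have h2 : cocycle x x + cocycle x x = 0 := by
    simpa using congrArg (fun f => f x x) h
  exact self_eq_neg.mp (eq_neg_of_add_eq_zero_left h2)

theorem wittBracket_leibniz (x y z : ℤ →₀ ℂ) :
    wittBracket x (wittBracket y z)
      = wittBracket (wittBracket x y) z + wittBracket y (wittBracket x z) := by
  induction x using Finsupp.induction_linear with
  | zero => simp
  | add x₁ x₂ h₁ h₂ => simp only [map_add, LinearMap.add_apply, h₁, h₂]; abel
  | single m a =>
    induction y using Finsupp.induction_linear with
    | zero => simp
    | add y₁ y₂ h₁ h₂ => simp only [map_add, LinearMap.add_apply, h₁, h₂]; abel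
    | single n b =>
      induction z using Finsupp.induction_linear with
      | zero => simp
      | add z₁ z₂ h₁ h₂ => simp only [map_add, h₁, h₂]; abel
      | single k d =>
        simp only [wittBracket_single']
        rw [show m + (n + k) = m + n + k by ring, show n + (m + k) = m + n + k by ring,
          ← Finsupp.single_add]
        congr 1
        push_cast
        ring

theorem cocycle_leibniz (x y z : ℤ →₀ ℂ) :
    cocycle x (wittBracket y z)
      = cocycle (wittBracket x y) z + cocycle y (wittBracket x z) := by
  induction x using Finsupp.induction_linear with
  | zero => simp
  | add x₁ x₂ h₁ h₂ => simp only [map_add, LinearMap.add_apply, h₁, h₂]; abel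
  | single m a =>
    induction y using Finsupp.induction_linear with
    | zero => simp
    | add y₁ y₂ h₁ h₂ => simp only [map_add, LinearMap.add_apply, h₁, h₂]; abel
    | single n b =>
      induction z using Finsupp.induction_linear with
      | zero => simp
      | add z₁ z₂ h₁ h₂ => simp only [map_add, h₁, h₂]; abel
      | single k d =>
        simp only [wittBracket_single', cocycle_single']
        rw [show m + (n + k) = m + n + k by ring, show n + (m + k) = m + n + k by ring]
        split_ifs with h
        · obtain rfl : k = -m - n := by omega
          push_cast
          ring
        · ring

noncomputable instance : Bracket VirasoroAlgebra VirasoroAlgebra :=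
  ⟨fun x y => (wittBracket x.1 y.1, cocycle x.1 y.1)⟩

noncomputable instance : LieRing VirasoroAlgebra where
  add_lie x y z := Prod.ext (LinearMap.map_add₂ wittBracket x.1 y.1 z.1)
    (LinearMap.map_add₂ cocycle x.1 y.1 z.1)
  lie_add x y z := Prod.ext (map_add (wittBracket x.1) y.1 z.1) (map_add (cocycle x.1) y.1 z.1)
  lie_self x := Prod.ext (wittBracket_self x.1) (cocycle_self x.1)
  leibniz_lie x y z := Prod.ext (wittBracket_leibniz x.1 y.1 z.1) (cocycle_leibniz x.1 y.1 z.1)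

noncomputable instance : LieAlgebra ℂ VirasoroAlgebra where
  lie_smul a x y := Prod.ext (map_smul (wittBracket x.1) a y.1) (map_smul (cocycle x.1) a y.1)

/-- The defining commutation relations of the Virasoro algebra. -/
theorem lie_L_L (m n : ℤ) :
    ⁅L m, L n⁆ = ((m : ℂ) - (n : ℂ)) • L (m + n)
      + (if m + n = 0 then ((m : ℂ) ^ 3 - (m : ℂ)) / 12 else 0) • C := by
  refine Prod.ext ?_ ?_
  · change wittBracket _ _ = ((m : ℂ) - (n : ℂ)) • Finsupp.single (m + n) (1 : ℂ)
      + (if m + n = 0 then ((m : ℂ) ^ 3 - (m : ℂ)) / 12 else 0) • (0 : ℤ →₀ ℂ)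
    simp [L, wittBracket_single']
  · change cocycle _ _ = ((m : ℂ) - (n : ℂ)) • (0 : ℂ)
      + (if m + n = 0 then ((m : ℂ) ^ 3 - (m : ℂ)) / 12 else 0) • (1 : ℂ)
    simp [L, cocycle_single']

/-- `C` is central. -/
theorem lie_C (x : VirasoroAlgebra) : ⁅C, x⁆ = 0 :=
  Prod.ext (LinearMap.map_zero₂ wittBracket x.1) (LinearMap.map_zero₂ cocycle x.1)

/-- The universal enveloping algebra `U(Vir)`. -/
abbrev U : Type := UniversalEnvelopingAlgebra ℂ VirasoroAlgebra

/-- The canonical map `Vir → U(Vir)`. -/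
noncomputable abbrev toU (x : VirasoroAlgebra) : U := UniversalEnvelopingAlgebra.ι ℂ x

/-- The left ideal of `U(Vir)` generated by `L m` (`m ≥ 1`), `L 0 - Δ` and `C - c`. -/
noncomputable def vermaIdeal (c Δ : ℂ) : Submodule U U :=
  Submodule.span U
    ({u | ∃ m : ℤ, 1 ≤ m ∧ u = toU (L m)} ∪
      {toU (L 0) - algebraMap ℂ U Δ, toU C - algebraMap ℂ U c})

/-- The Verma module with central charge `c` and highest weight `Δ`: the quotient of `U(Vir)` by
the left ideal `vermaIdeal c Δ`, as a left module over `U(Vir)`. -/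
abbrev VermaModule (c Δ : ℂ) : Type := U ⧸ vermaIdeal c Δ

/-- The highest weight vector of the Verma module: the class of `1`. -/
noncomputable def highestWeightVector (c Δ : ℂ) : VermaModule c Δ :=
  Submodule.Quotient.mk (1 : U)

/-- `ψ` is a singular vector at level `l` of the Verma module: it is not proportional to the
highest weight vector (in particular it is nonzero), it is annihilated by all `L m` with `m ≥ 1`,
and it has `L 0`-eigenvalue `Δ + l`. -/
structure IsSingularVector (c Δ : ℂ) (l : ℕ) (ψ : VermaModule c Δ) : Prop where
  not_proportional : ∀ a : ℂ, ψ ≠ a • highestWeightVector c Δ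
  annihilated : ∀ m : ℤ, 1 ≤ m → toU (L m) • ψ = 0
  weight : toU (L 0) • ψ = (Δ + (l : ℂ)) • ψ

end VirasoroAlgebra

namespace VirasoroAlgebra

open MvPolynomial Finsupp

/-! A singular vector is determined by its coefficient at `L (-1) ^ l`. Given two singular vectors,
a suitable multiple of one subtracted from the other has this coefficient equal to zero, hence
vanishes.

To see this, filter the Verma module by the number of factors in ordered monomials, so that the
associated graded space is a polynomial ring. There `L k` with `k ≥ 1` acts in top degree by the
derivation `lower k`, which is bracketing with `L k` truncated to negative modes
(`act_sub_lower_mem`). The top homogeneous component of a singular vector is therefore killed by all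
`lower k`. If `X N`, `N ≥ 1`, were its largest variable, then `lower N` would act on it as `(2N + 1)
X 0 ∂_N`, forcing the `X N`-derivative to vanish (`eq_zero_of_mem_vars`). So only powers of `X 0`
remain, and the `L 0`-weight selects `X 0 ^ l` (`eq_zero_of_coeff_eq_zero`).

Coefficients make sense because of a PBW theorem for the Verma module. Operators satisfying the
Virasoro relations are built on polynomials (`commutes`), and `u ↦ u · 1` kills `vermaIdeal`. The
map `toVerma` in the other direction intertwines the actions, so it recovers each vector from its
polynomial (`exists_toVerma_eq`). -/

/-- The polynomial algebra on which the Verma module is modelled: the variable `X i` stands for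
`L (-(i + 1))`, and a monomial for the product of its factors in order of increasing index. -/
abbrev PolyModel : Type := MvPolynomial ℕ ℂ

/-! ### Degree filtration and ordered monomials -/

/-- The polynomials of total degree less than `d`. -/
noncomputable abbrev degreeLT (d : ℕ) : Submodule ℂ PolyModel :=
  restrictSupport ℂ {s : ℕ →₀ ℕ | s.degree < d}

theorem degreeLT_le {d : ℕ} {N : Submodule ℂ PolyModel}
    (h : ∀ s : ℕ →₀ ℕ, s.degree < d → monomial s 1 ∈ N) : degreeLT d ≤ N := by
  rw [degreeLT, restrictSupport_eq_span, Submodule.span_le]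
  rintro _ ⟨s, hs, rfl⟩
  exact h s hs

theorem degreeLT_mono {d e : ℕ} (h : d ≤ e) : degreeLT d ≤ degreeLT e :=
  restrictSupport_mono _ fun _ hs => lt_of_lt_of_le hs h

theorem monomial_mem_degreeLT {d : ℕ} {s : ℕ →₀ ℕ} (h : s.degree < d) (a : ℂ) :
    monomial s a ∈ degreeLT d :=
  (monomial_mem_restrictSupport ℂ).2 (Or.inl h)

/-- The leading part of the action of `L m`: multiplication by the corresponding variable if
`m < 0`, and zero otherwise. -/
noncomputable def raise : ℤ → PolyModel →ₗ[ℂ] PolyModel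
  | Int.ofNat _ => 0
  | Int.negSucc i => LinearMap.mulLeft ℂ (X i)

theorem raise_negSucc (i : ℕ) (f : PolyModel) : raise (Int.negSucc i) f = X i * f := rfl

theorem raise_of_nonneg {m : ℤ} (h : 0 ≤ m) (f : PolyModel) : raise m f = 0 := by
  lift m to ℕ using h
  rfl

theorem monomial_zero_one : (monomial 0 1 : PolyModel) = 1 := rfl

theorem constr_monomial (φ : (ℕ →₀ ℕ) → PolyModel) (s : ℕ →₀ ℕ) :
    (basisMonomials ℕ ℂ).constr ℂ φ (monomial s 1) = φ s := by
  have h := (basisMonomials ℕ ℂ).constr_basis ℂ φ s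
  rwa [coe_basisMonomials] at h

theorem X_mul_monomial' (i : ℕ) (s : ℕ →₀ ℕ) :
    (X i * monomial s 1 : PolyModel) = monomial (s + single i 1) 1 := by
  rw [X, monomial_mul, add_comm, one_mul]

theorem raise_mem {d : ℕ} {f : PolyModel} (m : ℤ) (hf : f ∈ degreeLT d) :
    raise m f ∈ degreeLT (d + 1) := by
  suffices degreeLT d ≤ (degreeLT (d + 1)).comap (raise m) from this hf
  refine degreeLT_le fun s hs => ?_
  rw [Submodule.mem_comap]
  cases m with
  | ofNat m => exact zero_mem _
  | negSucc i =>
    rw [raise_negSucc, X_mul_monomial']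
    exact monomial_mem_degreeLT (by rw [map_add, degree_single]; omega) _

/-- `m` is negative and at most every index that occurs in the monomial `s`. -/
def Leads (m : ℤ) (s : ℕ →₀ ℕ) : Prop :=
  m < 0 ∧ ∀ j ∈ s.support, m ≤ Int.negSucc j

theorem mem_support_add_single {s : ℕ →₀ ℕ} {i j : ℕ} :
    j ∈ (s + single i 1).support ↔ j ∈ s.support ∨ j = i := by
  by_cases h : j = i
  · simp [h]
  · simp [h]

theorem Leads.mono {m k : ℤ} {s : ℕ →₀ ℕ} (h : Leads k s) (hmk : m ≤ k) : Leads m s :=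
  ⟨hmk.trans_lt h.1, fun j hj => hmk.trans (h.2 j hj)⟩

theorem Leads.add_single {m : ℤ} {s : ℕ →₀ ℕ} {i : ℕ} (h : Leads m s)
    (hi : m ≤ Int.negSucc i) : Leads m (s + single i 1) :=
  ⟨h.1, fun j hj => (mem_support_add_single.1 hj).elim (h.2 j) fun e => e ▸ hi⟩

theorem Leads.le_of_add_single {m : ℤ} {s : ℕ →₀ ℕ} {i : ℕ} (h : Leads m (s + single i 1)) :
    m ≤ Int.negSucc i :=
  h.2 i (mem_support_add_single.2 (Or.inr rfl))

theorem leads_zero {m : ℤ} (h : m < 0) : Leads m 0 :=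
  ⟨h, fun j hj => by simp at hj⟩

/-- The largest variable of a monomial. -/
def topVar (s : ℕ →₀ ℕ) : ℕ := s.support.sup id

theorem topVar_add_single {s : ℕ →₀ ℕ} {i : ℕ} (h : Leads (Int.negSucc i) s) :
    topVar (s + single i 1) = i := by
  refine le_antisymm (Finset.sup_le fun j hj => ?_)
    (Finset.le_sup (f := id) (mem_support_add_single.2 (Or.inr rfl)))
  rcases mem_support_add_single.1 hj with hj | rfl
  · have := h.2 j hj
    simp only [id]
    omega
  · exact le_rfl

theorem exists_eq_add_single {s : ℕ →₀ ℕ} (hs : s ≠ 0) :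
    ∃ i t, Leads (Int.negSucc i) t ∧ s = t + single i 1 := by
  have hne : s.support.Nonempty := support_nonempty_iff.2 hs
  obtain ⟨i, hi, hmax⟩ := s.support.exists_max_image id hne
  refine ⟨i, s - single i 1, ⟨Int.negSucc_lt_zero i, fun j hj => ?_⟩, ?_⟩
  · have : j ≤ i := hmax j (by
      contrapose hj
      rw [Finsupp.notMem_support_iff] at hj ⊢
      simp [hj])
    omega
  · rw [tsub_add_cancel_of_le]
    rw [single_le_iff]
    exact Nat.one_le_iff_ne_zero.2 (Finsupp.mem_support_iff.1 hi)

/-- A monomial is trivial or has a largest variable to split off. -/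
theorem monomial_cases (s : ℕ →₀ ℕ) :
    s = 0 ∨ ∃ i t, Leads (Int.negSucc i) t ∧ s = t + single i 1 :=
  (eq_or_ne s 0).imp_right exists_eq_add_single

/-! ### Construction of the operators on polynomials -/

/-- The scalar by which the central part of `⁅L m, L k⁆` acts. -/
noncomputable def centralTerm (c : ℂ) (m k : ℤ) : ℂ :=
  (if m + k = 0 then ((m : ℂ) ^ 3 - (m : ℂ)) / 12 else 0) * c

theorem centralTerm_swap (c : ℂ) (m k : ℤ) : centralTerm c k m = -centralTerm c m k := by
  unfold centralTerm
  rw [add_comm k m]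
  split_ifs with h
  · obtain rfl : k = -m := by omega
    push_cast
    ring
  · ring

variable (c Δ : ℂ)

open Classical in
/-- One step of the recursion that defines the action of `L m` on the polynomial model. -/
noncomputable def actStep (op : ℤ → PolyModel →ₗ[ℂ] PolyModel) (m : ℤ) :
    PolyModel →ₗ[ℂ] PolyModel :=
  (basisMonomials ℕ ℂ).constr ℂ fun s =>
    if Leads m s then raise m (monomial s 1)
    else if s = 0 then (if m = 0 then Δ else 0) • 1
    else
      op (Int.negSucc (topVar s)) (op m (monomial (s - single (topVar s) 1) 1))
        + ((m : ℂ) - (Int.negSucc (topVar s) : ℤ)) •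
            op (m + Int.negSucc (topVar s)) (monomial (s - single (topVar s) 1) 1)
        + centralTerm c m (Int.negSucc (topVar s)) • monomial (s - single (topVar s) 1) 1

/-- Approximations to the action of `L m`: the `p`-th one is correct in degrees less than `p`. -/
noncomputable def actApprox : ℕ → ℤ → PolyModel →ₗ[ℂ] PolyModel
  | 0 => raise
  | p + 1 => actStep c Δ (actApprox p)

/-- An already ordered product needs no reordering, so every stage, including the zeroth, is exact
on it. -/
theorem actApprox_of_leads (p : ℕ) {m : ℤ} {s : ℕ →₀ ℕ} (h : Leads m s) :
    actApprox c Δ p m (monomial s 1) = raise m (monomial s 1) := by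
  cases p with
  | zero => rfl
  | succ p =>
    rw [actApprox, actStep, constr_monomial, if_pos h]

theorem actApprox_succ_one (p : ℕ) {m : ℤ} (h : 0 ≤ m) :
    actApprox c Δ (p + 1) m 1 = (if m = 0 then Δ else 0) • 1 := by
  rw [actApprox, actStep, ← monomial_zero_one, constr_monomial,
    if_neg (fun hl => not_lt.2 h hl.1), if_pos rfl]

theorem actApprox_succ_add_single (p : ℕ) {m : ℤ} {s : ℕ →₀ ℕ} {i : ℕ}
    (h : Leads (Int.negSucc i) s) (hm : Int.negSucc i < m) :
    actApprox c Δ (p + 1) m (monomial (s + single i 1) 1)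
      = actApprox c Δ p (Int.negSucc i) (actApprox c Δ p m (monomial s 1))
        + ((m : ℂ) - (Int.negSucc i : ℤ)) • actApprox c Δ p (m + Int.negSucc i) (monomial s 1)
        + centralTerm c m (Int.negSucc i) • monomial s 1 := by
  rw [actApprox, actStep, constr_monomial,
    if_neg (fun hl => not_lt.2 hl.le_of_add_single hm),
    if_neg (fun hs => by simpa using DFunLike.congr_fun hs i), topVar_add_single h,
    add_tsub_cancel_right]

/-- In degrees less than `p`, `actApprox c Δ p m` has the leading part `raise m` and agrees with the
next approximation. -/
theorem actApprox_spec (p : ℕ) : ∀ (m : ℤ) (s : ℕ →₀ ℕ), s.degree < p →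
    actApprox c Δ p m (monomial s 1) - raise m (monomial s 1) ∈ degreeLT (s.degree + 1) ∧
      actApprox c Δ (p + 1) m (monomial s 1) = actApprox c Δ p m (monomial s 1) := by
  induction p with
  | zero => intro m s hs; omega
  | succ p ih =>
    have hlow : ∀ (m : ℤ) (e : ℕ) (f : PolyModel), e ≤ p → f ∈ degreeLT e →
        actApprox c Δ p m f - raise m f ∈ degreeLT e := by
      intro m e f he hf
      suffices degreeLT e ≤ (degreeLT e).comap (actApprox c Δ p m - raise m) from this hf
      exact degreeLT_le fun s hs => degreeLT_mono hs (ih m s (by omega)).1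
    have hstab : ∀ (m : ℤ) (f : PolyModel), f ∈ degreeLT p →
        actApprox c Δ (p + 1) m f = actApprox c Δ p m f := by
      intro m f hf
      suffices degreeLT p ≤ LinearMap.eqLocus (actApprox c Δ (p + 1) m) (actApprox c Δ p m) from
        this hf
      exact degreeLT_le fun s hs => (ih m s hs).2
    -- The term `L (-i-1) (L m t)` of the recursion applies an operator to something of the degree
    -- of the original monomial, so degree alone does not give termination. The top-degree part of
    -- `L m t` is, however, zero or still led by `X i`, where every stage is exact.
    have hraise : ∀ (q : ℕ) (m : ℤ) (s : ℕ →₀ ℕ) (i : ℕ), Leads (Int.negSucc i) s →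
        Int.negSucc i < m →
        actApprox c Δ q (Int.negSucc i) (raise m (monomial s 1))
          = raise m (monomial (s + single i 1) 1) := by
      intro q m s i h hm
      cases m with
      | ofNat m => simp [raise_of_nonneg]
      | negSucc j =>
        rw [raise_negSucc, X_mul_monomial', actApprox_of_leads c Δ q (h.add_single hm.le),
          raise_negSucc, X_mul_monomial', raise_negSucc, X_mul_monomial', add_right_comm]
    intro m s hs
    by_cases hl : Leads m s
    · rw [actApprox_of_leads c Δ _ hl, actApprox_of_leads c Δ _ hl, sub_self]
      exact ⟨zero_mem _, rfl⟩
    rcases monomial_cases s with rfl | ⟨i, t, h, rfl⟩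
    · have hm : 0 ≤ m := not_lt.1 fun hm => hl (leads_zero hm)
      rw [monomial_zero_one, actApprox_succ_one c Δ _ hm, actApprox_succ_one c Δ _ hm,
        raise_of_nonneg hm, sub_zero]
      refine ⟨Submodule.smul_mem _ _ ?_, rfl⟩
      rw [← monomial_zero_one]
      exact monomial_mem_degreeLT (Nat.lt_succ_self _) _
    · have hm : Int.negSucc i < m := not_le.1 fun hm => hl ((h.mono hm).add_single hm)
      have hdeg : (t + single i 1).degree = t.degree + 1 := by rw [map_add, degree_single]
      rw [hdeg] at hs ⊢
      have ht : (monomial t 1 : PolyModel) ∈ degreeLT (t.degree + 1) :=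
        monomial_mem_degreeLT (Nat.lt_succ_self _) _
      have htp : (monomial t 1 : PolyModel) ∈ degreeLT p := degreeLT_mono (by omega) ht
      -- The remainder `w` has lower degree, where the induction hypothesis applies.
      obtain ⟨w, hw, hw'⟩ : ∃ w ∈ degreeLT (t.degree + 1),
          actApprox c Δ p m (monomial t 1) = raise m (monomial t 1) + w :=
        ⟨_, hlow m _ _ (by omega) ht, by abel⟩
      have hup : ∀ (k : ℤ) (f : PolyModel), f ∈ degreeLT (t.degree + 1) →
          actApprox c Δ p k f ∈ degreeLT (t.degree + 1 + 1) := by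
        intro k f hf
        have h1 := degreeLT_mono (Nat.le_succ _) (hlow k _ f (by omega) hf)
        simpa using add_mem h1 (raise_mem k hf)
      have hwp : w ∈ degreeLT p := degreeLT_mono (by omega) hw
      rw [actApprox_succ_add_single c Δ _ h hm, actApprox_succ_add_single c Δ _ h hm,
        hstab m _ htp, hstab _ _ htp, hw', map_add, map_add, hraise _ _ _ _ h hm,
        hraise _ _ _ _ h hm, hstab _ _ hwp]
      refine ⟨?_, rfl⟩
      rw [add_assoc (raise _ _ + _), add_assoc (raise _ _), add_sub_cancel_left]
      exact add_mem (hup _ _ hw) (add_mem (Submodule.smul_mem _ _ (hup _ _ ht))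
        (Submodule.smul_mem _ _ (degreeLT_mono (Nat.le_succ _) ht)))

/-- The action of `L m` on the polynomial model of the Verma module. -/
noncomputable def act (m : ℤ) : PolyModel →ₗ[ℂ] PolyModel :=
  (basisMonomials ℕ ℂ).constr ℂ fun s => actApprox c Δ (s.degree + 1) m (monomial s 1)

theorem act_monomial (m : ℤ) (s : ℕ →₀ ℕ) :
    act c Δ m (monomial s 1) = actApprox c Δ (s.degree + 1) m (monomial s 1) := by
  rw [act, constr_monomial]

theorem actApprox_monomial_eq (m : ℤ) {s : ℕ →₀ ℕ} {p : ℕ} (h : s.degree < p) :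
    actApprox c Δ p m (monomial s 1) = act c Δ m (monomial s 1) := by
  induction p, h using Nat.le_induction with
  | base => rw [act_monomial]
  | succ p hp ih => rw [(actApprox_spec c Δ p m s hp).2, ih]

theorem actApprox_eq (m : ℤ) {f : PolyModel} {p : ℕ} (hf : f ∈ degreeLT p) :
    actApprox c Δ p m f = act c Δ m f := by
  suffices degreeLT p ≤ LinearMap.eqLocus (actApprox c Δ p m) (act c Δ m) from this hf
  exact degreeLT_le fun s hs => actApprox_monomial_eq c Δ m hs

theorem act_sub_raise_mem (m : ℤ) {f : PolyModel} {d : ℕ} (hf : f ∈ degreeLT d) :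
    act c Δ m f - raise m f ∈ degreeLT d := by
  suffices degreeLT d ≤ (degreeLT d).comap (act c Δ m - raise m) from this hf
  refine degreeLT_le fun s hs => degreeLT_mono (Nat.succ_le_of_lt hs) ?_
  have := (actApprox_spec c Δ _ m s (Nat.lt_succ_self _)).1
  rwa [actApprox_monomial_eq c Δ m (Nat.lt_succ_self _)] at this

theorem act_mem (m : ℤ) {f : PolyModel} {d : ℕ} (hf : f ∈ degreeLT d) :
    act c Δ m f ∈ degreeLT (d + 1) := by
  simpa using add_mem (degreeLT_mono (Nat.le_succ _) (act_sub_raise_mem c Δ m hf)) (raise_mem m hf)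

theorem act_of_leads {m : ℤ} {s : ℕ →₀ ℕ} (h : Leads m s) :
    act c Δ m (monomial s 1) = raise m (monomial s 1) := by
  rw [act_monomial, actApprox_of_leads c Δ _ h]

theorem act_negSucc {s : ℕ →₀ ℕ} {i : ℕ} (h : Leads (Int.negSucc i) s) :
    act c Δ (Int.negSucc i) (monomial s 1) = monomial (s + single i 1) 1 := by
  rw [act_of_leads c Δ h, raise_negSucc, X_mul_monomial']

theorem act_one {m : ℤ} (h : 0 ≤ m) : act c Δ m 1 = (if m = 0 then Δ else 0) • 1 := by
  rw [← monomial_zero_one, act_monomial, monomial_zero_one, actApprox_succ_one c Δ _ h]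

/-! ### The Virasoro relations -/

/-- `act c Δ m (act c Δ k f)` is computed by the Virasoro relation. -/
def Commutes (m k : ℤ) (f : PolyModel) : Prop :=
  act c Δ m (act c Δ k f) = act c Δ k (act c Δ m f)
    + ((m : ℂ) - (k : ℂ)) • act c Δ (m + k) f + centralTerm c m k • f

theorem Commutes.symm {m k : ℤ} {f : PolyModel} (h : Commutes c Δ m k f) :
    Commutes c Δ k m f := by
  unfold Commutes at *
  rw [h, centralTerm_swap c m k, add_comm k m]
  module

theorem commutes_self (m : ℤ) (f : PolyModel) : Commutes c Δ m m f := by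
  have h : centralTerm c m m = 0 := self_eq_neg.1 (centralTerm_swap c m m)
  rw [Commutes, h]
  simp

theorem commutes_of_leads_of_lt {m : ℤ} {s : ℕ →₀ ℕ} {i : ℕ} (h : Leads (Int.negSucc i) s)
    (hm : Int.negSucc i < m) : Commutes c Δ m (Int.negSucc i) (monomial s 1) := by
  have hs : (monomial s 1 : PolyModel) ∈ degreeLT (s.degree + 1) :=
    monomial_mem_degreeLT (Nat.lt_succ_self _) _
  have hs' := degreeLT_mono (Nat.le_succ _) hs
  -- Unfolding stage `s.degree + 3` once leaves stage `s.degree + 2`, which is still exact on `act c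
  -- Δ m (monomial s 1)`, of degree at most `s.degree + 1`.
  rw [Commutes, act_negSucc c Δ h,
    ← actApprox_monomial_eq c Δ m (p := s.degree + 1 + 1 + 1)
      (by rw [map_add, degree_single]; omega),
    actApprox_succ_add_single c Δ _ h hm, actApprox_eq c Δ m hs',
    actApprox_eq c Δ _ (act_mem c Δ m hs), actApprox_eq c Δ _ hs']

/-- If `m < k`, then `m` leads `s` as well and the two modes exchange roles. -/
theorem commutes_of_leads (m : ℤ) {k : ℤ} {s : ℕ →₀ ℕ} (h : Leads k s) :
    Commutes c Δ m k (monomial s 1) := by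
  rcases lt_trichotomy m k with hmk | rfl | hmk
  · obtain ⟨i, rfl⟩ := Int.eq_negSucc_of_lt_zero (hmk.trans h.1)
    exact (commutes_of_leads_of_lt c Δ (h.mono hmk.le) hmk).symm
  · exact commutes_self c Δ _ _
  · obtain ⟨i, rfl⟩ := Int.eq_negSucc_of_lt_zero h.1
    exact commutes_of_leads_of_lt c Δ h hmk

/-- The cocycle identity: the central part of the Jacobi identity used in `commutes_act`. -/
theorem centralTerm_jacobi (m k n : ℤ) :
    ((k : ℂ) - n) * centralTerm c m (k + n)
      = ((m : ℂ) - k) * centralTerm c (m + k) n + ((m : ℂ) - n) * centralTerm c k (m + n) := by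
  unfold centralTerm
  rw [← add_assoc, ← add_assoc, add_comm k m]
  split_ifs with h
  · obtain rfl : n = -m - k := by omega
    push_cast
    ring
  · ring

/-- The relation for `m` and `k` propagates along `act c Δ n`, by the Jacobi identity. -/
theorem commutes_act {m k n : ℤ} {f : PolyModel} (hm : Commutes c Δ m n f)
    (hk : Commutes c Δ k n f) (hmk : Commutes c Δ m k f)
    (hm' : Commutes c Δ m n (act c Δ k f)) (hk' : Commutes c Δ k n (act c Δ m f))
    (h1 : Commutes c Δ m (k + n) f) (h2 : Commutes c Δ k (m + n) f)
    (h3 : Commutes c Δ (m + k) n f) : Commutes c Δ m k (act c Δ n f) := by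
  unfold Commutes at *
  rw [hk, hm, h3]
  simp only [map_add, map_smul, hm', hk', hmk, h1, h2]
  have hJ := centralTerm_jacobi c m k n
  rw [show k + (m + n) = m + (k + n) by ring, show m + k + n = m + (k + n) by ring]
  push_cast
  match_scalars <;> first | ring1 | linear_combination hJ

theorem Commutes.add {m k : ℤ} {f g : PolyModel} (hf : Commutes c Δ m k f)
    (hg : Commutes c Δ m k g) : Commutes c Δ m k (f + g) := by
  unfold Commutes at *
  simp only [map_add, hf, hg]
  module

theorem commutes_of_forall_monomial {m k : ℤ} {d : ℕ}
    (h : ∀ s : ℕ →₀ ℕ, s.degree < d → Commutes c Δ m k (monomial s 1)) {f : PolyModel}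
    (hf : f ∈ degreeLT d) : Commutes c Δ m k f := by
  suffices degreeLT d ≤ LinearMap.eqLocus (act c Δ m ∘ₗ act c Δ k)
      (act c Δ k ∘ₗ act c Δ m + ((m : ℂ) - (k : ℂ)) • act c Δ (m + k)
        + centralTerm c m k • LinearMap.id) from this hf
  exact degreeLT_le h

theorem exists_mem_degreeLT (f : PolyModel) : ∃ d, f ∈ degreeLT d :=
  ⟨f.totalDegree + 1, fun _ hs => Nat.lt_succ_of_le (le_totalDegree hs)⟩

/-- The operators `act c Δ m` satisfy the Virasoro relations. -/
theorem commutes (m k : ℤ) (f : PolyModel) : Commutes c Δ m k f := by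
  suffices H : ∀ (d : ℕ) (m k : ℤ) (f : PolyModel), f ∈ degreeLT d → Commutes c Δ m k f by
    obtain ⟨d, hd⟩ := exists_mem_degreeLT f
    exact H d m k f hd
  clear m k f
  intro d
  induction d with
  | zero =>
    intro m k f hf
    exact commutes_of_forall_monomial c Δ (fun s hs => absurd hs (Nat.not_lt_zero _)) hf
  | succ d ih =>
    intro m k f hf
    refine commutes_of_forall_monomial c Δ (fun s hs => ?_) hf
    rcases monomial_cases s with rfl | ⟨i, t, h, rfl⟩
    · by_cases hk : k < 0
      · exact commutes_of_leads c Δ m (leads_zero hk)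
      by_cases hm : m < 0
      · exact (commutes_of_leads c Δ k (leads_zero hm)).symm
      rw [monomial_zero_one, Commutes, act_one c Δ (not_lt.1 hk), act_one c Δ (not_lt.1 hm),
        act_one c Δ (by omega : 0 ≤ m + k), map_smul, map_smul, act_one c Δ (not_lt.1 hk),
        act_one c Δ (not_lt.1 hm), centralTerm]
      by_cases hk0 : k = 0 <;> by_cases hm0 : m = 0
      · simp [hk0, hm0]
      · simp [hk0, hm0]
      · simp [hk0, hm0]
      · simp [hk0, hm0, show m + k ≠ 0 by omega]
    by_cases hk : k ≤ Int.negSucc i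
    · exact commutes_of_leads c Δ m ((h.mono hk).add_single hk)
    by_cases hm : m ≤ Int.negSucc i
    · exact (commutes_of_leads c Δ k ((h.mono hm).add_single hm)).symm
    rw [not_le] at hk hm
    rw [map_add, degree_single] at hs
    have ht : (monomial t 1 : PolyModel) ∈ degreeLT d := monomial_mem_degreeLT (by omega) _
    -- `act c Δ k (monomial t 1)` may be too large for `ih`. Its leading part is zero or led by `X
    -- i`, so the relation holds there by construction, and `ih` covers the remainder.
    have hact : ∀ m k : ℤ, Int.negSucc i < k →
        Commutes c Δ m (Int.negSucc i) (act c Δ k (monomial t 1)) := by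
      intro m k hk
      rw [← add_sub_cancel (raise k (monomial t 1)) (act c Δ k (monomial t 1))]
      refine Commutes.add c Δ ?_ (ih _ _ _ (act_sub_raise_mem c Δ k ht))
      cases k with
      | ofNat k =>
        exact ih _ _ (0 : PolyModel) (zero_mem _)
      | negSucc j =>
        rw [raise_negSucc, X_mul_monomial']
        exact commutes_of_leads c Δ m (h.add_single hk.le)
    rw [← act_negSucc c Δ h]
    exact commutes_act c Δ (ih _ _ _ ht) (ih _ _ _ ht) (ih _ _ _ ht) (hact m k hk)
      (hact k m hm) (ih _ _ _ ht) (ih _ _ _ ht) (ih _ _ _ ht)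

/-! ### The representation of the enveloping algebra -/

/-- The action of `∑ m, f m • L m` on the polynomial model. -/
noncomputable def wittAct : (ℤ →₀ ℂ) →ₗ[ℂ] Module.End ℂ PolyModel :=
  Finsupp.linearCombination ℂ (act c Δ)

theorem wittAct_single (m : ℤ) (a : ℂ) : wittAct c Δ (single m a) = a • act c Δ m := by
  rw [wittAct, linearCombination_single]

theorem wittAct_wittBracket (f g : ℤ →₀ ℂ) :
    wittAct c Δ (wittBracket f g) + (cocycle f g * c) • (1 : Module.End ℂ PolyModel)
      = wittAct c Δ f * wittAct c Δ g - wittAct c Δ g * wittAct c Δ f := by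
  induction f using Finsupp.induction_linear with
  | zero => simp
  | add f₁ f₂ h₁ h₂ =>
    simp only [map_add, LinearMap.add_apply, add_mul, mul_add, add_smul] at h₁ h₂ ⊢
    rw [add_add_add_comm, h₁, h₂]
    abel
  | single m a =>
    induction g using Finsupp.induction_linear with
    | zero => simp
    | add g₁ g₂ h₁ h₂ =>
      simp only [map_add, add_mul, mul_add, add_smul] at h₁ h₂ ⊢
      rw [add_add_add_comm, h₁, h₂]
      abel
    | single k b =>
      refine LinearMap.ext fun p => ?_
      have h := commutes c Δ m k p
      rw [Commutes, centralTerm] at h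
      rw [wittBracket_single', cocycle_single', wittAct_single, wittAct_single, wittAct_single]
      simp only [LinearMap.add_apply, LinearMap.smul_apply, LinearMap.sub_apply,
        Module.End.mul_apply, Module.End.one_apply, map_smul, h]
      module

attribute [local instance 100] LieRing.ofAssociativeRing

/-- The polynomial model as a representation of the Virasoro algebra. -/
noncomputable def polyRep : VirasoroAlgebra →ₗ⁅ℂ⁆ Module.End ℂ PolyModel where
  toFun x := wittAct c Δ x.1 + (x.2 * c) • 1
  map_add' x y := by
    change wittAct c Δ (x.1 + y.1) + ((x.2 + y.2) * c) • 1 = _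
    rw [map_add]
    module
  map_smul' a x := by
    change wittAct c Δ (a • x.1) + ((a • x.2) * c) • 1 = _
    rw [map_smul, smul_eq_mul, RingHom.id_apply]
    module
  map_lie' {x y} := by
    change wittAct c Δ (wittBracket x.1 y.1) + (cocycle x.1 y.1 * c) • 1 = _
    rw [wittAct_wittBracket, LieRing.of_associative_ring_bracket]
    simp only [add_mul, mul_add, smul_mul_assoc, mul_smul_comm, one_mul, mul_one]
    module

theorem polyRep_L (m : ℤ) : polyRep c Δ (L m) = act c Δ m := by
  change wittAct c Δ (single m 1) + ((0 : ℂ) * c) • 1 = _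
  rw [wittAct_single]
  module

theorem polyRep_C : polyRep c Δ C = c • 1 := by
  change wittAct c Δ 0 + ((1 : ℂ) * c) • 1 = _
  rw [map_zero]
  module

/-- The polynomial model as a representation of `U(Vir)`. -/
noncomputable def polyRepU : U →ₐ[ℂ] Module.End ℂ PolyModel :=
  UniversalEnvelopingAlgebra.lift ℂ (polyRep c Δ)

theorem polyRepU_toU (x : VirasoroAlgebra) : polyRepU c Δ (toU x) = polyRep c Δ x :=
  UniversalEnvelopingAlgebra.lift_ι_apply ℂ _ x

/-- By the universal property, the canonical map lifts to `U → S`; followed by the inclusion it is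
the identity, so every element lies in `S`. -/
theorem subalgebra_eq_top {S : Subalgebra ℂ U} (h : ∀ x, toU x ∈ S) : S = ⊤ := by
  let f : VirasoroAlgebra →ₗ⁅ℂ⁆ S :=
    { (UniversalEnvelopingAlgebra.ι ℂ (L := VirasoroAlgebra)).toLinearMap.codRestrict
        (Subalgebra.toSubmodule S) h with
      map_lie' := fun {x y} => Subtype.ext
        ((UniversalEnvelopingAlgebra.ι ℂ (L := VirasoroAlgebra)).map_lie x y) }
  have hid : S.val.comp (UniversalEnvelopingAlgebra.lift ℂ f) = AlgHom.id ℂ U := by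
    refine UniversalEnvelopingAlgebra.hom_ext ℂ (LieHom.ext fun x => ?_)
    change S.val (UniversalEnvelopingAlgebra.lift ℂ f (UniversalEnvelopingAlgebra.ι ℂ x)) = _
    rw [UniversalEnvelopingAlgebra.lift_ι_apply]
    rfl
  refine Algebra.eq_top_iff.2 fun u => ?_
  have := AlgHom.congr_fun hid u
  rw [AlgHom.id_apply] at this
  rw [← this]
  exact (UniversalEnvelopingAlgebra.lift ℂ f u).2

/-- This makes `u ↦ u · 1` descend to the Verma module, giving the map to polynomials. -/
theorem polyRepU_one_of_mem {u : U} (hu : u ∈ vermaIdeal c Δ) : polyRepU c Δ u 1 = 0 := by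
  induction hu using Submodule.span_induction with
  | mem u hu =>
    rcases hu with ⟨m, hm, rfl⟩ | rfl | rfl
    · rw [polyRepU_toU, polyRep_L, act_one c Δ (by omega), if_neg (by omega), zero_smul]
    · rw [map_sub, polyRepU_toU, polyRep_L, AlgHom.commutes, LinearMap.sub_apply,
        act_one c Δ le_rfl, if_pos rfl, Module.algebraMap_end_apply, sub_self]
    · rw [map_sub, polyRepU_toU, polyRep_C, AlgHom.commutes, LinearMap.sub_apply,
        Module.algebraMap_end_apply, LinearMap.smul_apply, Module.End.one_apply, sub_self]
  | zero => rw [map_zero, LinearMap.zero_apply]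
  | add x y _ _ hx hy => rw [map_add, LinearMap.add_apply, hx, hy, add_zero]
  | smul a x _ hx => rw [smul_eq_mul, map_mul, Module.End.mul_apply, hx, map_zero]

/-! ### Comparison with the Verma module -/

/-- The product in `U(Vir)` of the factors of a monomial, in order of increasing index. -/
noncomputable def orderedProd (s : ℕ →₀ ℕ) : U :=
  ((s.toMultiset.sort (· ≥ ·)).map fun i => toU (L (Int.negSucc i))).prod

theorem orderedProd_zero : orderedProd 0 = 1 := by
  simp [orderedProd]

theorem orderedProd_add_single {s : ℕ →₀ ℕ} {i : ℕ} (h : Leads (Int.negSucc i) s) :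
    orderedProd (s + single i 1) = toU (L (Int.negSucc i)) * orderedProd s := by
  have hs : (s + single i 1).toMultiset = i ::ₘ s.toMultiset := by
    rw [toMultiset_add, toMultiset_single, one_smul, add_comm, Multiset.singleton_add]
  have hle : ∀ j ∈ s.toMultiset, i ≥ j := by
    intro j hj
    have := h.2 j (by rwa [mem_toMultiset] at hj)
    omega
  rw [orderedProd, hs, Multiset.sort_cons (r := (· ≥ ·)) i _ hle, List.map_cons, List.prod_cons, orderedProd]

/-- The linear map from the polynomial model to the Verma module that sends a monomial to the
corresponding ordered product applied to the highest weight vector. -/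
noncomputable def toVerma : PolyModel →ₗ[ℂ] VermaModule c Δ :=
  (basisMonomials ℕ ℂ).constr ℂ fun s => orderedProd s • highestWeightVector c Δ

theorem toVerma_monomial (s : ℕ →₀ ℕ) :
    toVerma c Δ (monomial s 1) = orderedProd s • highestWeightVector c Δ := by
  have h := (basisMonomials ℕ ℂ).constr_basis ℂ
    (fun s => orderedProd s • highestWeightVector c Δ) s
  rwa [coe_basisMonomials] at h

theorem toVerma_one : toVerma c Δ 1 = highestWeightVector c Δ := by
  rw [← monomial_zero_one, toVerma_monomial, orderedProd_zero, one_smul]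

theorem toU_smul_highestWeightVector {m : ℤ} (hm : 0 ≤ m) :
    toU (L m) • highestWeightVector c Δ = (if m = 0 then Δ else 0) • highestWeightVector c Δ := by
  rw [highestWeightVector, ← Submodule.Quotient.mk_smul, ← Submodule.Quotient.mk_smul,
    Submodule.Quotient.eq, smul_eq_mul, mul_one]
  apply Submodule.subset_span
  rcases hm.eq_or_lt with rfl | hm
  · right
    left
    rw [if_pos rfl, Algebra.algebraMap_eq_smul_one]
  · left
    exact ⟨m, hm, by rw [if_neg hm.ne', zero_smul, sub_zero]⟩

theorem toU_C_smul_highestWeightVector :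
    toU C • highestWeightVector c Δ = c • highestWeightVector c Δ := by
  rw [highestWeightVector, ← Submodule.Quotient.mk_smul, ← Submodule.Quotient.mk_smul,
    Submodule.Quotient.eq, smul_eq_mul, mul_one, ← Algebra.algebraMap_eq_smul_one]
  exact Submodule.subset_span (Or.inr (Or.inr rfl))

theorem toU_mul (x y : VirasoroAlgebra) : toU x * toU y = toU y * toU x + toU ⁅x, y⁆ := by
  have h : toU ⁅x, y⁆ = toU x * toU y - toU y * toU x := LieHom.map_lie _ x y
  rw [h]
  abel

theorem toU_C_mul (u : U) : toU C * u = u * toU C := by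
  have h : Subalgebra.centralizer ℂ {toU C} = ⊤ := subalgebra_eq_top fun x => by
    rw [Subalgebra.mem_centralizer_iff]
    rintro _ rfl
    rw [toU_mul, lie_C, show toU 0 = 0 from LinearMap.map_zero (UniversalEnvelopingAlgebra.ι ℂ).toLinearMap, add_zero]
  have hu : u ∈ Subalgebra.centralizer ℂ {toU C} := h ▸ Algebra.mem_top
  exact (Subalgebra.mem_centralizer_iff ℂ).1 hu _ rfl

theorem toU_C_smul (ψ : VermaModule c Δ) : toU C • ψ = c • ψ := by
  obtain ⟨u, rfl⟩ := Submodule.Quotient.mk_surjective _ ψ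
  have hu : (Submodule.Quotient.mk u : VermaModule c Δ) = u • highestWeightVector c Δ := by
    rw [highestWeightVector, ← Submodule.Quotient.mk_smul, smul_eq_mul, mul_one]
  rw [hu, ← mul_smul, toU_C_mul, mul_smul, toU_C_smul_highestWeightVector, smul_comm]

theorem toU_L_smul_smul (m k : ℤ) (ψ : VermaModule c Δ) :
    toU (L m) • toU (L k) • ψ = toU (L k) • toU (L m) • ψ
      + ((m : ℂ) - (k : ℂ)) • toU (L (m + k)) • ψ + centralTerm c m k • ψ := by
  have hadd (x y : VirasoroAlgebra) : toU (x + y) = toU x + toU y := 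
    LinearMap.map_add (UniversalEnvelopingAlgebra.ι ℂ).toLinearMap x y
  have hsmul (a : ℂ) (x : VirasoroAlgebra) : toU (a • x) = a • toU x := 
    LinearMap.map_smul (UniversalEnvelopingAlgebra.ι ℂ).toLinearMap a x
  rw [← mul_smul, toU_mul, lie_L_L, hadd, hsmul, hsmul, add_smul, add_smul, mul_smul,
    smul_assoc, smul_assoc, toU_C_smul, smul_smul _ c, ← add_assoc, centralTerm]

theorem toVerma_act_of_leads {m : ℤ} {s : ℕ →₀ ℕ} (h : Leads m s) :
    toVerma c Δ (act c Δ m (monomial s 1)) = toU (L m) • toVerma c Δ (monomial s 1) := by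
  obtain ⟨i, rfl⟩ := Int.eq_negSucc_of_lt_zero h.1
  rw [act_negSucc c Δ h, toVerma_monomial, toVerma_monomial, orderedProd_add_single h, mul_smul]

theorem toVerma_act_of_forall_monomial {m : ℤ} {d : ℕ}
    (h : ∀ s : ℕ →₀ ℕ, s.degree < d →
      toVerma c Δ (act c Δ m (monomial s 1)) = toU (L m) • toVerma c Δ (monomial s 1))
    {f : PolyModel} (hf : f ∈ degreeLT d) :
    toVerma c Δ (act c Δ m f) = toU (L m) • toVerma c Δ f := by
  suffices degreeLT d ≤ LinearMap.eqLocus (toVerma c Δ ∘ₗ act c Δ m)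
      (Algebra.lsmul ℂ ℂ (VermaModule c Δ) (toU (L m)) ∘ₗ toVerma c Δ) from this hf
  exact degreeLT_le h

/-- `toVerma` intertwines the actions of `L m`. -/
theorem toVerma_act (m : ℤ) (f : PolyModel) :
    toVerma c Δ (act c Δ m f) = toU (L m) • toVerma c Δ f := by
  suffices H : ∀ (d : ℕ) (m : ℤ) (f : PolyModel), f ∈ degreeLT d →
      toVerma c Δ (act c Δ m f) = toU (L m) • toVerma c Δ f by
    obtain ⟨d, hd⟩ := exists_mem_degreeLT f
    exact H d m f hd
  clear m f
  intro d
  induction d with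
  | zero =>
    intro m f hf
    exact toVerma_act_of_forall_monomial c Δ (fun s hs => absurd hs (Nat.not_lt_zero _)) hf
  | succ d ih =>
    intro m f hf
    refine toVerma_act_of_forall_monomial c Δ (fun s hs => ?_) hf
    by_cases hl : Leads m s
    · exact toVerma_act_of_leads c Δ hl
    rcases monomial_cases s with rfl | ⟨i, t, h, rfl⟩
    · have hm : 0 ≤ m := not_lt.1 fun hm => hl (leads_zero hm)
      rw [monomial_zero_one, act_one c Δ hm, map_smul, toVerma_one,
        toU_smul_highestWeightVector c Δ hm]
    have hm : Int.negSucc i < m := not_le.1 fun hm => hl ((h.mono hm).add_single hm)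
    rw [map_add, degree_single] at hs
    have ht : (monomial t 1 : PolyModel) ∈ degreeLT d := monomial_mem_degreeLT (by omega) _
    -- As in `commutes`: the leading part is handled by ordering, the remainder by induction on
    -- degree.
    have hi : toVerma c Δ (act c Δ (Int.negSucc i) (act c Δ m (monomial t 1)))
        = toU (L (Int.negSucc i)) • toVerma c Δ (act c Δ m (monomial t 1)) := by
      rw [← add_sub_cancel (raise m (monomial t 1)) (act c Δ m (monomial t 1)), map_add, map_add,
        map_add, smul_add, ih _ _ (act_sub_raise_mem c Δ m ht)]
      congr 1
      cases m with
      | ofNat m => exact ih _ (0 : PolyModel) (zero_mem _)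
      | negSucc j =>
        rw [raise_negSucc, X_mul_monomial']
        exact toVerma_act_of_leads c Δ (h.add_single hm.le)
    rw [← act_negSucc c Δ h, commutes c Δ m (Int.negSucc i) (monomial t 1), map_add, map_add,
      map_smul, map_smul, hi, ih _ _ ht, ih _ _ ht, ← toU_L_smul_smul, toVerma_act_of_leads c Δ h]

/-- The element `∑ m, g m • L m` of the Virasoro algebra. -/
def ofWitt (g : ℤ →₀ ℂ) : VirasoroAlgebra := (g, 0)

theorem toVerma_polyRep (x : VirasoroAlgebra) (f : PolyModel) :
    toVerma c Δ (polyRep c Δ x f) = toU x • toVerma c Δ f := by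
  obtain ⟨g, z⟩ := x
  have hC : toVerma c Δ (polyRep c Δ C f) = toU C • toVerma c Δ f := by
    rw [polyRep_C, toU_C_smul, LinearMap.smul_apply, Module.End.one_apply, map_smul]
  have hL (m : ℤ) : toVerma c Δ (polyRep c Δ (L m) f) = toU (L m) • toVerma c Δ f := by
    rw [polyRep_L, toVerma_act]
  let S : Submodule ℂ VirasoroAlgebra := LinearMap.eqLocus
    (toVerma c Δ ∘ₗ LinearMap.applyₗ f ∘ₗ (polyRep c Δ).toLinearMap)
    (LinearMap.applyₗ (toVerma c Δ f) ∘ₗ (Algebra.lsmul ℂ ℂ (VermaModule c Δ)).toLinearMap ∘ₗ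
      (UniversalEnvelopingAlgebra.ι ℂ).toLinearMap)
  have hg : ofWitt g ∈ S := by
    induction g using Finsupp.induction_linear with
    | zero => exact S.zero_mem
    | add g₁ g₂ h₁ h₂ =>
      have : ofWitt (g₁ + g₂) = ofWitt g₁ + ofWitt g₂ := Prod.ext rfl (add_zero (0 : ℂ)).symm
      exact this ▸ S.add_mem h₁ h₂
    | single m a =>
      have : ofWitt (single m a) = a • L m :=
        Prod.ext (by change _ = a • single m (1 : ℂ); simp [ofWitt]) (mul_zero a).symm
      exact this ▸ S.smul_mem a (hL m)
  have hz : (g, z) = ofWitt g + z • C :=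
    Prod.ext (by change g = g + z • (0 : ℤ →₀ ℂ); simp)
      (by change z = (0 : ℂ) + z • (1 : ℂ); simp)
  exact hz ▸ S.add_mem hg (S.smul_mem z hC)

theorem toVerma_polyRepU (u : U) (f : PolyModel) :
    toVerma c Δ (polyRepU c Δ u f) = u • toVerma c Δ f := by
  let S : Subalgebra ℂ U :=
    { carrier := {u | ∀ f, toVerma c Δ (polyRepU c Δ u f) = u • toVerma c Δ f}
      mul_mem' := fun {a b} ha hb f => by
        rw [map_mul, Module.End.mul_apply, ha, hb, mul_smul]
      add_mem' := fun {a b} ha hb f => by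
        rw [map_add, LinearMap.add_apply, map_add, ha, hb, add_smul]
      algebraMap_mem' := fun a f => by
        rw [AlgHom.commutes, Module.algebraMap_end_apply, map_smul, algebraMap_smul] }
  have hS : S = ⊤ := subalgebra_eq_top fun x f => by rw [polyRepU_toU, toVerma_polyRep]
  have hu : u ∈ S := hS ▸ Algebra.mem_top
  exact hu f

/-- Every vector of the Verma module comes from the polynomial model, together with its
annihilators. -/
theorem exists_toVerma_eq (ψ : VermaModule c Δ) :
    ∃ f : PolyModel, toVerma c Δ f = ψ ∧ ∀ u : U, u • ψ = 0 → polyRepU c Δ u f = 0 := by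
  obtain ⟨v, rfl⟩ := Submodule.Quotient.mk_surjective _ ψ
  -- For the annihilators, `u • ψ = 0` means `u * v ∈ vermaIdeal c Δ`, and that ideal kills `1` in
  -- the model.
  refine ⟨polyRepU c Δ v 1, ?_, fun u hu => ?_⟩
  · rw [toVerma_polyRepU, toVerma_one, highestWeightVector, ← Submodule.Quotient.mk_smul,
      smul_eq_mul, mul_one]
  · rw [← Submodule.Quotient.mk_smul, Submodule.Quotient.mk_eq_zero, smul_eq_mul] at hu
    rw [← Module.End.mul_apply, ← map_mul, polyRepU_one_of_mem c Δ hu]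

/-! ### Leading part of the positive modes -/

/-- The derivation that is the leading part of the action of `L k`, `k ≥ 1`. -/
noncomputable def lower (k : ℕ) : Derivation ℂ PolyModel PolyModel :=
  mkDerivation ℂ fun j => if k ≤ j then ((k : ℂ) + j + 1) • X (j - k) else 0

theorem lower_X (k j : ℕ) :
    lower k (X j) = if k ≤ j then ((k : ℂ) + j + 1) • X (j - k) else 0 :=
  mkDerivation_X _ _ _

theorem lower_X_mul (k i : ℕ) (f : PolyModel) :
    lower k (X i * f) = X i * lower k f
      + ((k : ℤ) - (Int.negSucc i : ℤ) : ℂ) • raise ((k : ℤ) + Int.negSucc i) f := by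
  rw [Derivation.leibniz, smul_eq_mul, smul_eq_mul, lower_X]
  congr 1
  split_ifs with h
  · rw [show (k : ℤ) + Int.negSucc i = Int.negSucc (i - k) by omega, raise_negSucc,
      mul_smul_comm, mul_comm f]
    congr 1
    push_cast
    ring
  · rw [raise_of_nonneg (by omega), smul_zero, mul_zero]

theorem lower_monomial_isHomogeneous (k : ℕ) (s : ℕ →₀ ℕ) (a : ℂ) :
    (lower k (monomial s a)).IsHomogeneous s.degree := by
  rw [lower, mkDerivation_monomial, ← mem_homogeneousSubmodule]
  refine Submodule.smul_mem _ _ (Submodule.sum_mem _ fun i hi => ?_)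
  dsimp only
  split_ifs with h
  · rw [mem_homogeneousSubmodule, smul_eq_mul]
    have hs : s.degree = (s - single i 1).degree + 1 := by
      have : s - single i 1 + single i 1 = s :=
        tsub_add_cancel_of_le (single_le_iff.2 (Nat.one_le_iff_ne_zero.2
          (Finsupp.mem_support_iff.1 hi)))
      conv_lhs => rw [← this]
      rw [map_add, degree_single]
    rw [hs]
    exact (isHomogeneous_monomial _ rfl).mul
      ((mem_homogeneousSubmodule _ _).1 (Submodule.smul_mem _ _ (isHomogeneous_X ℂ _)))
  · rw [smul_zero]
    exact zero_mem _

theorem lower_isHomogeneous (k : ℕ) {f : PolyModel} {n : ℕ} (hf : f.IsHomogeneous n) :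
    (lower k f).IsHomogeneous n := by
  rw [f.as_sum, map_sum]
  refine IsHomogeneous.sum _ _ _ fun s hs => ?_
  have hsn : s.degree = n := by
    by_contra h
    exact MvPolynomial.mem_support_iff.1 hs (hf.coeff_eq_zero h)
  exact hsn ▸ lower_monomial_isHomogeneous k s _

theorem act_natCast_mem {k : ℕ} {f : PolyModel} {d : ℕ} (hf : f ∈ degreeLT d) :
    act c Δ k f ∈ degreeLT d := by
  simpa [raise_of_nonneg (Int.natCast_nonneg k)] using act_sub_raise_mem c Δ k hf

/-- Commuting `L k` past the largest factor gives, in top degree, exactly the Leibniz recursion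
`lower_X_mul`; the central term and the corrections to `raise` have lower degree. -/
theorem act_sub_lower_mem {k : ℕ} (hk : 1 ≤ k) {d : ℕ} {f : PolyModel}
    (hf : f ∈ degreeLT (d + 1)) : act c Δ k f - lower k f ∈ degreeLT d := by
  suffices H : ∀ d, degreeLT (d + 1) ≤
      (degreeLT d).comap (act c Δ k - (lower k).toLinearMap) from H d hf
  clear hf f d
  intro d
  induction d with
  | zero =>
    refine degreeLT_le fun s hs => ?_
    obtain rfl := (degree_eq_zero_iff s).1 (Nat.lt_one_iff.1 hs)
    rw [Submodule.mem_comap, monomial_zero_one, LinearMap.sub_apply,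
      act_one c Δ (Int.natCast_nonneg k), if_neg (by omega), zero_smul, zero_sub]
    change -(lower k 1) ∈ _
    rw [Derivation.map_one_eq_zero, neg_zero]
    exact zero_mem _
  | succ d ih =>
    refine degreeLT_le fun s hs => ?_
    rcases monomial_cases s with rfl | ⟨i, t, h, rfl⟩
    · exact degreeLT_mono (Nat.le_succ _) (ih (monomial_mem_degreeLT (by simp) 1))
    rw [map_add, degree_single] at hs
    have ht : (monomial t 1 : PolyModel) ∈ degreeLT (d + 1) := monomial_mem_degreeLT (by omega) _
    have h1 : act c Δ k (monomial t 1) - lower k (monomial t 1) ∈ degreeLT d := ih ht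
    have h2 := raise_mem (Int.negSucc i) h1
    have h3 := act_sub_raise_mem c Δ (Int.negSucc i) (act_natCast_mem c Δ (k := k) ht)
    have h4 := Submodule.smul_mem _ ((k : ℤ) - (Int.negSucc i : ℤ) : ℂ)
      (act_sub_raise_mem c Δ (k + Int.negSucc i) ht)
    have h5 := Submodule.smul_mem _ (centralTerm c k (Int.negSucc i)) ht
    rw [Submodule.mem_comap, LinearMap.sub_apply]
    change act c Δ k _ - lower k _ ∈ _
    rw [← X_mul_monomial', lower_X_mul, X_mul_monomial', ← act_negSucc c Δ h,
      commutes c Δ k (Int.negSucc i) (monomial t 1)]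
    convert add_mem (add_mem h2 h3) (add_mem h4 h5) using 1
    rw [map_sub, raise_negSucc _ (lower _ _)]
    module

theorem lower_mem {k : ℕ} (hk : 1 ≤ k) {d : ℕ} {f : PolyModel} (hf : f ∈ degreeLT d) :
    lower k f ∈ degreeLT d := by
  cases d with
  | zero =>
    have : f = 0 := MvPolynomial.support_eq_empty.1 (Finset.eq_empty_of_forall_notMem fun s hs =>
      Nat.not_lt_zero _ (hf hs))
    rw [this, map_zero]
    exact zero_mem _
  | succ d =>
    -- `lower` does not depend on `c` and `Δ`, so its degree bound can be read off from the action
    -- at the values `0`, `0`.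
    have h := degreeLT_mono (Nat.le_succ d) (act_sub_lower_mem 0 0 hk hf)
    simpa using sub_mem (act_natCast_mem 0 0 (k := k) hf) h

/-- A polynomial that is killed by all the derivations `lower k`, `k ≥ 1`, depends on the first
variable only. -/
theorem eq_zero_of_mem_vars {g : PolyModel} (hg : ∀ k, 1 ≤ k → lower k g = 0) {i : ℕ}
    (hi : i ∈ g.vars) : i = 0 := by
  obtain ⟨N, hN, hmax⟩ := g.vars.exists_max_image (fun j => j) ⟨i, hi⟩
  by_contra hi0
  have hN1 : 1 ≤ N := (Nat.one_le_iff_ne_zero.2 hi0).trans (hmax i hi)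
  -- On the variables of `g`, all of index at most `N`, `lower N` is nonzero only at `X N`, which it
  -- sends to `(2N + 1) X 0`.
  have hD : lower N g = ((((N : ℂ) + N + 1) • X 0 : PolyModel) • pderiv N) g := by
    refine derivation_eq_of_forall_mem_vars fun j hj => ?_
    rw [lower_X, Derivation.smul_apply]
    have hj : j ≤ N := hmax j hj
    rcases hj.eq_or_lt with rfl | hjN
    · rw [if_pos le_rfl, pderiv_X_self, Nat.sub_self, smul_eq_mul, mul_one]
    · rw [if_neg (not_le.2 hjN), pderiv_X_of_ne hjN.ne, smul_zero]
  rw [hg N hN1, Derivation.smul_apply, smul_eq_mul] at hD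
  have hc : ((N : ℂ) + N + 1) ≠ 0 := by exact_mod_cast Nat.succ_ne_zero (N + N)
  have hp : pderiv N g = 0 :=
    (mul_eq_zero.1 hD.symm).resolve_left (smul_ne_zero hc (X_ne_zero 0))
  obtain ⟨s, hs, hsN⟩ := (mem_vars_iff_mem_support N).1 hN
  have hsub : s - single N 1 + single N 1 = s := tsub_add_cancel_of_le
    (single_le_iff.2 (Nat.one_le_iff_ne_zero.2 (Finsupp.mem_support_iff.1 hsN)))
  have hcoeff := coeff_pderiv (i := N) g (s - single N 1)
  rw [hp, coeff_zero, hsub] at hcoeff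
  rcases mul_eq_zero.1 hcoeff.symm with h | h
  · exact MvPolynomial.mem_support_iff.1 hs h
  · exact Nat.cast_add_one_ne_zero _ h

/-! ### Weights and uniqueness -/

/-- The level of a monomial, the variable `X i` having level `i + 1`. -/
noncomputable def level (s : ℕ →₀ ℕ) : ℕ := Finsupp.weight (fun i => i + 1) s

theorem level_add_single (s : ℕ →₀ ℕ) (i : ℕ) : level (s + single i 1) = level s + (i + 1) := by
  rw [level, map_add, weight_single, one_smul, level]

theorem act_zero_monomial (s : ℕ →₀ ℕ) :
    act c Δ 0 (monomial s 1) = (Δ + level s) • monomial s 1 := by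
  induction hd : s.degree generalizing s with
  | zero =>
    obtain rfl := (degree_eq_zero_iff s).1 hd
    rw [monomial_zero_one, act_one c Δ le_rfl, if_pos rfl, level, map_zero, Nat.cast_zero,
      add_zero]
  | succ d ih =>
    rcases monomial_cases s with rfl | ⟨i, t, h, rfl⟩
    · simp at hd
    rw [map_add, degree_single] at hd
    rw [← act_negSucc c Δ h, commutes c Δ 0 (Int.negSucc i) (monomial t 1), ih t (by omega),
      map_smul, zero_add, centralTerm, if_neg (by omega), level_add_single]
    push_cast
    module

theorem coeff_act_zero (s : ℕ →₀ ℕ) (f : PolyModel) :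
    coeff s (act c Δ 0 f) = (Δ + level s) * coeff s f := by
  suffices lcoeff ℂ s ∘ₗ act c Δ 0 = (Δ + level s) • lcoeff ℂ s from LinearMap.congr_fun this f
  refine (basisMonomials ℕ ℂ).ext fun t => ?_
  rw [coe_basisMonomials, LinearMap.comp_apply, act_zero_monomial, map_smul, LinearMap.smul_apply,
    lcoeff_apply, coeff_monomial]
  split_ifs with h
  · rw [h]
  · simp

/-- A singular vector of the polynomial model is determined by one coefficient, that of the power
of the first variable. -/
theorem eq_zero_of_coeff_eq_zero {l : ℕ} {f : PolyModel}
    (hann : ∀ k : ℕ, 1 ≤ k → act c Δ k f = 0) (hw : act c Δ 0 f = (Δ + l) • f)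
    (hcoeff : coeff (single 0 l) f = 0) : f = 0 := by
  by_contra hf
  obtain ⟨s, hs, hsd⟩ : ∃ s ∈ f.support, s.degree = f.totalDegree := by
    obtain ⟨s, hs, h⟩ := f.support.exists_mem_eq_sup (MvPolynomial.support_nonempty.2 hf)
      fun s => s.degree
    exact ⟨s, hs, h.symm⟩
  set p := f.totalDegree
  set g := homogeneousComponent p f with hg
  have hgs : coeff s g = coeff s f := by rw [hg, coeff_homogeneousComponent, if_pos hsd]
  have hfg : f - g ∈ degreeLT p := by
    intro t ht
    have ht' : coeff t (f - g) ≠ 0 := MvPolynomial.mem_support_iff.1 ht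
    rw [coeff_sub, hg, coeff_homogeneousComponent] at ht'
    split_ifs at ht' with h
    · exact absurd (sub_self _) ht'
    · rw [sub_zero] at ht'
      exact lt_of_le_of_ne (le_totalDegree (MvPolynomial.mem_support_iff.2 ht')) h
  have hlow : ∀ k, 1 ≤ k → lower k g = 0 := by
    intro k hk
    have hfp : f ∈ degreeLT (p + 1) := fun t ht => Nat.lt_succ_of_le (le_totalDegree ht)
    have h1 := act_sub_lower_mem c Δ hk hfp
    rw [hann k hk, zero_sub, neg_mem_iff] at h1
    -- Since `lower k g` is homogeneous of degree `p`, membership in `degreeLT p` forces it to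
    -- vanish.
    have h2 : lower k g ∈ degreeLT p := by
      have := sub_mem h1 (lower_mem hk hfg)
      rwa [map_sub, sub_sub_cancel] at this
    refine MvPolynomial.ext _ _ fun t => ?_
    by_contra ht
    rw [coeff_zero] at ht
    have h3 : t.degree < p := h2 (MvPolynomial.mem_support_iff.2 ht)
    exact ht ((lower_isHomogeneous k (homogeneousComponent_isHomogeneous p f)).coeff_eq_zero h3.ne)
  have hs0 : s = single 0 (s 0) := by
    refine Finsupp.ext fun i => ?_
    rcases eq_or_ne i 0 with rfl | hi
    · simp
    · rw [single_eq_of_ne hi]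
      by_contra hsi
      refine hi (eq_zero_of_mem_vars hlow ((mem_vars_iff_mem_support i).2 ⟨s, ?_, Finsupp.mem_support_iff.2 hsi⟩))
      rw [MvPolynomial.mem_support_iff, hgs]
      exact MvPolynomial.mem_support_iff.1 hs
  -- Monomials are eigenvectors of `L 0`, so each one occurring in `f` has level `l`; the level of
  -- `X 0 ^ n` is `n`.
  have hlev : level s = l := by
    have h := coeff_act_zero c Δ s f
    rw [hw, coeff_smul, smul_eq_mul] at h
    have := mul_right_cancel₀ (MvPolynomial.mem_support_iff.1 hs) h
    exact_mod_cast (add_left_cancel this).symm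
  have hl : s 0 = l := by
    rw [← hlev, hs0, level, weight_single]
    simp
  rw [hl] at hs0
  rw [hs0] at hs
  exact MvPolynomial.mem_support_iff.1 hs hcoeff

/-- A singular vector of the Verma module comes from a singular vector of the polynomial model. -/
theorem IsSingularVector.exists_toVerma_eq {c Δ : ℂ} {l : ℕ} {ψ : VermaModule c Δ}
    (h : IsSingularVector c Δ l ψ) : ∃ f : PolyModel, toVerma c Δ f = ψ ∧
      (∀ k : ℕ, 1 ≤ k → act c Δ k f = 0) ∧ act c Δ 0 f = (Δ + l) • f ∧
      coeff (single 0 l) f ≠ 0 := by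
  obtain ⟨f, hf, hann⟩ := VirasoroAlgebra.exists_toVerma_eq c Δ ψ
  have h1 : ∀ k : ℕ, 1 ≤ k → act c Δ k f = 0 := fun k hk => by
    have := hann _ (h.annihilated k (by omega))
    rwa [polyRepU_toU, polyRep_L] at this
  have h2 : act c Δ 0 f = (Δ + l) • f := by
    have := hann (toU (L 0) - algebraMap ℂ U (Δ + l))
      (by rw [sub_smul, h.weight, algebraMap_smul, sub_self])
    rwa [map_sub, polyRepU_toU, polyRep_L, AlgHom.commutes, LinearMap.sub_apply,
      Module.algebraMap_end_apply, sub_eq_zero] at this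
  refine ⟨f, hf, h1, h2, fun h0 => h.not_proportional 0 ?_⟩
  rw [← hf, eq_zero_of_coeff_eq_zero c Δ h1 h2 h0, map_zero, zero_smul]

end VirasoroAlgebra

theorem mainTheorem4 (c Δ : ℂ) (l : ℕ) (hl : 1 ≤ l)
    (ψ₁ ψ₂ : VirasoroAlgebra.VermaModule c Δ)
    (h₁ : VirasoroAlgebra.IsSingularVector c Δ l ψ₁)
    (h₂ : VirasoroAlgebra.IsSingularVector c Δ l ψ₂) :
    ∃ a : ℂ, a ≠ 0 ∧ ψ₂ = a • ψ₁ := by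
  obtain ⟨f₁, rfl, hann₁, hw₁, hc₁⟩ := h₁.exists_toVerma_eq
  obtain ⟨f₂, rfl, hann₂, hw₂, hc₂⟩ := h₂.exists_toVerma_eq
  set a := MvPolynomial.coeff (Finsupp.single 0 l) f₂ / MvPolynomial.coeff (Finsupp.single 0 l) f₁
    with ha
  refine ⟨a, div_ne_zero hc₂ hc₁, ?_⟩
  have h : f₂ - a • f₁ = 0 := by
    refine VirasoroAlgebra.eq_zero_of_coeff_eq_zero c Δ (l := l) (fun k hk => ?_) ?_ ?_
    · rw [map_sub, map_smul, hann₁ k hk, hann₂ k hk, smul_zero, sub_zero]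
    · rw [map_sub, map_smul, hw₁, hw₂, smul_sub, smul_comm a]
    · rw [MvPolynomial.coeff_sub, MvPolynomial.coeff_smul, smul_eq_mul, ha, div_mul_cancel₀ _ hc₁,
        sub_self]
  rw [sub_eq_zero.1 h, map_smul]
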